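/- For $n\ge 3$ let $\Pi_n^+$ be the graph whose vertices are all permutations $x=x_1x_2\cdots x_n$ of $\{1,\dots,n\}$ (in one-line notation), where two permutations are adjacent if and only if they differ by swapping two cyclically neighboring entries, i.e., by one of the $n$ transpositions of the positions $\{i,i+1\}$ with $1\le i\le n$, where position $n+1$ is read as position $1$. (Thus $\Pi_n^+$ is the permutahedron, in which neighboring entries $x_i,x_{i+1}$ with $1\le i<n$ may be swapped, together with the edges that swap the first and the last entry.) A Hamilton cycle $C=(y_1,\dots,y_N)$ of a graph $G$ with $N$ vertices is called $k$-symmetric, for a divisor $k$ of $N$, if the mapping $y_i\mapsto y_{i+N/k}$ for all $i=1,\dots,N$ (indices modulo $N$) is an automorphism of $G$. A cyclic sequence $C$ of strings of length $n$ has one track if the $|C|\times n$ matrix whose rows are the strings of $C$ has a column such that every other column is a cyclically shifted copy of it. **Theorem.** For every odd $n\ge 3$ there is an $n$-symmetric Hamilton cycle $C$ in $\Pi_n^+$ that has one track and is balanced: each of the $n$ transpositions of cyclically neighboring positions is used equally often, namely in exactly $(n-1)!$ of the $n!$ steps of $C$ (including the step from the last vertex back to the first). -/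

import Mathlib

open scoped Nat

namespace HamiltonCompression

/-- The vertex `x_i` of a closed walk `C = (x_0, …, x_{N-1}, x_0)` of length `N`, where the index `i`
is read modulo `N`. -/
def vertexAt {V : Type*} {G : SimpleGraph V} {a : V} (C : G.Walk a a) (i : ℕ) : V :=
  C.getVert (i % C.length)

/-- A closed walk `C = (x_0, …, x_{N-1}, x_0)` is `k`-symmetric if `k` divides `N` and
`x_i ↦ x_{i + N/k}` (indices modulo `N`) is an automorphism of the graph. -/
def IsSymmetric {V : Type*} {G : SimpleGraph V} {a : V} (C : G.Walk a a) (k : ℕ) : Prop :=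
  k ∣ C.length ∧
    ∃ f : G ≃g G, ∀ i : ℕ, f (vertexAt C i) = vertexAt C (i + C.length / k)

/-- The transposition of the positions `i` and `i + 1` (modulo `n`). For `i` the last position it
is the transposition of the last and the first position. -/
def cyclicTransposition (n : ℕ) (i : Fin n) : Equiv.Perm (Fin n) :=
  Equiv.swap i (finRotate n i)

/-- The permutahedron. The vertex `x` stands for the string `x 0, x 1, …, x (n-1)` (one-line
notation), and `x` and `x * Equiv.swap i j` differ by swapping the entries at the
positions `i` and `j`. -/
def permutahedron (n : ℕ) : SimpleGraph (Equiv.Perm (Fin n)) :=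
  SimpleGraph.fromRel fun x y =>
    ∃ i j : Fin n, (i : ℕ) + 1 = (j : ℕ) ∧ y = x * Equiv.swap i j

/-- The permutahedron with additional edges for the transposition of the first and the last
entry. -/
def permutahedronPlus (n : ℕ) : SimpleGraph (Equiv.Perm (Fin n)) :=
  permutahedron n ⊔ SimpleGraph.fromRel fun x y =>
    ∃ i j : Fin n, (i : ℕ) = 0 ∧ (j : ℕ) + 1 = n ∧ y = x * Equiv.swap i j

/-- The cyclic sequence `C` of strings of length `n` consists of `t` tracks: in the matrix whose
rows are the strings of `C` there are `t` columns such that every column is a cyclically shifted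
copy of one of them. -/
def HasTracks {n : ℕ} {G : SimpleGraph (Equiv.Perm (Fin n))} {a : Equiv.Perm (Fin n)}
    (C : G.Walk a a) (t : ℕ) : Prop :=
  ∃ T : Finset (Fin n), T.card = t ∧
    ∀ j : Fin n, ∃ c ∈ T, ∃ s : ℕ, ∀ i : ℕ, vertexAt C i j = vertexAt C (i + s) c

/-- The number of steps `x_m → x_{m+1}` of the closed walk `C` (including the step from the last
vertex back to the first) that swap the entries at the positions `i` and `i + 1` (modulo `n`). -/
def transpositionCount {n : ℕ} {G : SimpleGraph (Equiv.Perm (Fin n))} {a : Equiv.Perm (Fin n)}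
    (C : G.Walk a a) (i : Fin n) : ℕ :=
  ((Finset.range C.length).filter fun m =>
    vertexAt C (m + 1) = vertexAt C m * cyclicTransposition n i).card

end HamiltonCompression

namespace HamiltonCompression

/-! Write `n = m + 1` with `m` even. Shifting positions cyclically acts freely on the permutations,
and each orbit has one representative with symbol `0` in position `0`. It suffices to list these `m
!` representatives as a path whose last member is adjacent to the shift of the first: running
through the path and then through its successive shifts closes up after `n` rounds (`rotationLift`).
The shift by one round gives the `n`-symmetry and the single track. It also lowers the index of
every transposition by one, so all are used equally often.

The path keeps `0` fixed and swaps neighbors among the other `m` entries, leading from `0 a l` to `0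
l a`; swapping the two ends of the latter gives `a l 0`, the shift of `0 a l`. Swaps alternate
parity and the path has `m ! - 1` steps, an odd number, so its ends must differ in parity. They do,
since rotating an even number `m` of letters is an odd permutation. Existence follows from
`Laceable`, proved by induction from four letters; `m = 2` is immediate. -/

open List

/-! ### Paths of neighboring swaps on lists -/

section ListPaths

variable {α : Type*}

/-- Two lists are related if the second arises from the first by swapping two neighboring
entries. -/
inductive AdjSwap : List α → List α → Prop
  | swap (a b : α) (l : List α) : AdjSwap (a :: b :: l) (b :: a :: l)
  | cons (a : α) {l l' : List α} : AdjSwap l l' → AdjSwap (a :: l) (a :: l')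

theorem AdjSwap.perm {l l' : List α} (h : AdjSwap l l') : l ~ l' := by
  induction h with
  | swap a b l => exact List.Perm.swap b a l
  | cons a _ ih => exact ih.cons a

theorem AdjSwap.map {β : Type*} (f : α → β) {l l' : List α} (h : AdjSwap l l') :
    AdjSwap (l.map f) (l'.map f) := by
  induction h with
  | swap a b l => exact .swap _ _ _
  | cons a _ ih => exact .cons _ ih

/-- `P` is a path from `u` to `v` that moves by swaps of neighboring entries. -/
structure IsSwapPath (u v : List α) (P : List (List α)) : Prop where
  chain : P.IsChain AdjSwap
  head : P.head? = some u
  last : P.getLast? = some v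
  nodup : P.Nodup

/-- `P` is a path from `u` to `v` that moves by swaps of neighboring entries and visits every
rearrangement of `u`. -/
structure IsHamiltonSwapPath (u v : List α) (P : List (List α)) : Prop
    extends IsSwapPath u v P where
  mem_iff : ∀ w, w ∈ P ↔ w ~ u

theorem IsSwapPath.map {β : Type*} {f : List α → List β} (hf : Function.Injective f)
    (hs : ∀ l l', AdjSwap l l' → AdjSwap (f l) (f l')) {u v : List α} {P : List (List α)}
    (h : IsSwapPath u v P) : IsSwapPath (f u) (f v) (P.map f) where
  chain := List.isChain_map_of_isChain f hs h.chain
  head := by simp [h.head]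
  last := by simp [h.last]
  nodup := h.nodup.map hf

theorem IsSwapPath.append {u v u' v' : List α} {P Q : List (List α)} (hP : IsSwapPath u v P)
    (hQ : IsSwapPath u' v' Q) (hs : AdjSwap v u') (hd : P.Disjoint Q) :
    IsSwapPath u v' (P ++ Q) where
  chain := by
    refine List.isChain_append.2 ⟨hP.chain, hQ.chain, ?_⟩
    intro x hx y hy
    rw [hP.last] at hx
    rw [hQ.head] at hy
    simp only [Option.mem_def, Option.some.injEq] at hx hy
    exact hx ▸ hy ▸ hs
  head := by simp [hP.head]
  last := by simp [hQ.last]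
  nodup := hP.nodup.append hQ.nodup hd

theorem IsSwapPath.perm_of_mem {u v : List α} {P : List (List α)} (h : IsSwapPath u v P) :
    ∀ w ∈ P, w ~ u := by
  obtain ⟨hc, hh, -, -⟩ := h
  induction P generalizing u with
  | nil => simp
  | cons x P ih =>
    obtain rfl : x = u := by simpa using hh
    intro w hw
    rcases List.mem_cons.1 hw with rfl | hw
    · exact .refl _
    · cases P with
      | nil => simp at hw
      | cons y P =>
        rw [List.isChain_cons_cons] at hc
        exact (ih hc.2 rfl w hw).trans hc.1.perm.symm

/-- A path stays among the rearrangements of `u` without repetition, so counting shows that it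
exhausts them. -/
theorem IsSwapPath.isHamiltonSwapPath {u v : List α} {P : List (List α)} (h : IsSwapPath u v P)
    (hlen : P.length = u.length !) : IsHamiltonSwapPath u v P where
  toIsSwapPath := h
  mem_iff w := by
    refine ⟨h.perm_of_mem w, fun hw => ?_⟩
    have hsub : P ⊆ u.permutations := fun x hx => List.mem_permutations.2 (h.perm_of_mem x hx)
    have hp : P ~ u.permutations := (h.nodup.subperm hsub).perm_of_length_le
      (by rw [List.length_permutations, hlen])
    exact hp.mem_iff.2 (List.mem_permutations.2 hw)

theorem IsHamiltonSwapPath.length {u v : List α} {P : List (List α)}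
    (h : IsHamiltonSwapPath u v P) (hu : u.Nodup) : P.length = u.length ! := by
  have hp : P ~ u.permutations := (List.perm_ext_iff_of_nodup h.nodup (List.nodup_permutations u hu)).2
    fun w => by rw [h.mem_iff, List.mem_permutations]
  rw [hp.length_eq, List.length_permutations]

/-- Entries of `a :: b :: l ++ [c]` at distance two are distinct. -/
def DistinctAtTwo (a b : α) : List α → α → Prop
  | [], c => a ≠ c
  | d :: l, c => a ≠ d ∧ DistinctAtTwo b d l c

theorem distinctAtTwo_of_nodup {a b c x y : α} {l : List α}
    (h : (a :: b :: (l ++ [x, y])).Nodup) (hc : x ≠ c) : DistinctAtTwo a b (l ++ [x, y]) c := by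
  induction l generalizing a b with
  | nil => simp [DistinctAtTwo]; grind
  | cons d l ih =>
    refine ⟨by grind, ih h.of_cons⟩

/-- The list obtained by swapping the entries at the positions `k` and `k + 1`. -/
def swapAt : ℕ → List α → List α
  | 0, a :: b :: l => b :: a :: l
  | k + 1, a :: l => a :: swapAt k l
  | _, l => l

theorem adjSwap_swapAt : ∀ (k : ℕ) (l : List α), k + 1 < l.length → AdjSwap l (swapAt k l)
  | 0, a :: b :: l, _ => .swap a b l
  | k + 1, a :: l, h => .cons a (adjSwap_swapAt k l (by simpa using h))
  | 0, [a], h => by simp at h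
  | 0, [], h => by simp at h
  | k + 1, [], h => by simp at h

/-- The sequence of lists obtained from `l` by the given swaps of neighboring entries. -/
def swapTrace (l : List α) : List ℕ → List (List α)
  | [] => [l]
  | k :: ks => l :: swapTrace (swapAt k l) ks

theorem swapTrace_head (l : List α) (ks : List ℕ) : (swapTrace l ks).head? = some l := by
  cases ks <;> rfl

theorem swapTrace_isChain (l : List α) (ks : List ℕ) (h : ∀ k ∈ ks, k + 1 < l.length) :
    (swapTrace l ks).IsChain AdjSwap := by
  induction ks generalizing l with
  | nil => exact .singleton _
  | cons k ks ih =>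
    have hs := adjSwap_swapAt k l (h k (by simp))
    refine List.isChain_cons.2 ⟨fun y hy => ?_, ih _ fun j hj => ?_⟩
    · rw [swapTrace_head] at hy
      exact (by simpa using hy : swapAt k l = y) ▸ hs
    · rw [← hs.perm.length_eq]
      exact h j (by simp [hj])

/-! ### Parity of inversions -/

variable [LinearOrder α]

/-- The number of inversions of a list. -/
def inversions : List α → ℕ
  | [] => 0
  | a :: l => l.countP (· < a) + inversions l

theorem inversions_cons_add_cons (a : α) {l l' : List α} (h : l ~ l') :
    inversions (a :: l) + inversions l' = inversions (a :: l') + inversions l := by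
  simp only [inversions, h.countP_eq]
  omega

theorem inversions_swap {a b : α} (hab : a ≠ b) (l : List α) :
    inversions (a :: b :: l) % 2 ≠ inversions (b :: a :: l) % 2 := by
  simp only [inversions, List.countP_cons]
  rcases lt_or_gt_of_ne hab with h | h
  · simp [h, h.not_gt]; omega
  · simp [h, h.not_gt]; omega

/-- Moving `a` to the end takes `l.length` neighboring swaps, each flipping the parity. -/
theorem inversions_append_singleton (a : α) (l : List α) (h : (a :: l).Nodup) :
    inversions (l ++ [a]) % 2 = (inversions (a :: l) + l.length) % 2 := by
  induction l with
  | nil => simp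
  | cons b l ih =>
    have h1 := ih (h.sublist (by simp))
    have h2 := inversions_swap (a := a) (b := b) (by grind) l
    have h3 := inversions_cons_add_cons b (List.perm_append_singleton a l)
    simp only [List.cons_append, List.length_cons] at *
    omega

/-- A swap flips both parities at once, so the parity of their sum is preserved. This transfers
parity along relabelings that need not be monotone. -/
theorem inversions_map_add {β : Type*} [LinearOrder β] {f : α → β} (hf : Function.Injective f)
    {l l' : List α} (h : l ~ l') (hl : l.Nodup) :
    (inversions (l.map f) + inversions l) % 2 = (inversions (l'.map f) + inversions l') % 2 := by
  induction h with
  | nil => rfl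
  | cons a h ih =>
    have h1 := inversions_cons_add_cons a h
    have h2 := inversions_cons_add_cons (f a) (h.map f)
    have h3 := ih hl.of_cons
    simp only [List.map_cons]
    omega
  | swap a b l =>
    have hab : b ≠ a := by grind
    have h1 := inversions_swap hab l
    have h2 := inversions_swap (hf.ne hab) (l.map f)
    simp only [List.map_cons]
    omega
  | trans h _ ih ih' => exact (ih hl).trans (ih' (h.nodup hl))

/-! ### Laceability: the inductive step -/

/-- Any two rearrangements of a list of `n` distinct elements that have different parity and
different heads are the ends of a path through all rearrangements. -/
def Laceable (α : Type*) [LinearOrder α] (n : ℕ) : Prop :=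
  ∀ u v : List α, u.length = n → u.Nodup → v ~ u → u.head? ≠ v.head? →
    inversions u % 2 ≠ inversions v % 2 → ∃ P, IsHamiltonSwapPath u v P

/-- Behind `d` at least two entries remain, and swapping two of them corrects the parity. -/
theorem exists_cons_perm_inversions_ne {d : α} {u : List α} (hu : u.Nodup) (hd : d ∈ u)
    (hlen : 3 ≤ u.length) (p : ℕ) : ∃ r, d :: r ~ u ∧ inversions (d :: r) % 2 ≠ p % 2 := by
  have hp := (List.perm_cons_erase hd).symm
  have hl := hp.length_eq
  obtain ⟨x, y, r, hr⟩ : ∃ x y r, u.erase d = x :: y :: r := by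
    match h : u.erase d with
    | [] => simp [h] at hl; omega
    | [x] => simp [h] at hl; omega
    | x :: y :: r => exact ⟨x, y, r, rfl⟩
  rw [hr] at hp
  have hnd := hp.nodup_iff.2 hu
  have h1 := inversions_swap (a := x) (b := y) (by grind) r
  have h2 := inversions_cons_add_cons d (List.Perm.swap y x r)
  by_cases hq : inversions (d :: x :: y :: r) % 2 = p % 2
  · exact ⟨y :: x :: r, ((List.Perm.swap x y r).cons d).trans hp, by omega⟩
  · exact ⟨_, hp, hq⟩

/-- Rearrangements are grouped into blocks by first letter, visited in the order `a :: cs`. A block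
is left when the next first letter stands second, and swapping the first two entries enters the next
block. There the previous first letter stands second, so the different heads required by `IH` amount
to distinctness at distance two in `h, a, cs, h'`. -/
theorem Laceable.exists_isSwapPath_blocks {n : ℕ} (IH : Laceable α n) (hn : 3 ≤ n)
    (b h' : α) (t' : List α) (cs : List α) :
    ∀ (h a : α) (t : List α), (a :: h :: t).Nodup → b :: h' :: t' ~ a :: h :: t →
      (h :: t).length = n → (a :: cs).Nodup → (∀ x ∈ cs, x ∈ a :: h :: t) →
      (a :: cs).getLast? = some b → DistinctAtTwo h a cs h' →
      inversions (a :: h :: t) % 2 ≠ inversions (b :: h' :: t') % 2 →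
      ∃ P, IsSwapPath (a :: h :: t) (b :: h' :: t') P ∧
        ∀ w, w ∈ P ↔ w ~ a :: h :: t ∧ ∃ x ∈ a :: cs, w.head? = some x := by
  have mem_map_cons : ∀ (a : α) (u v : List α) (P : List (List α)), IsHamiltonSwapPath u v P →
      ∀ w, w ∈ P.map (List.cons a) ↔ w ~ a :: u ∧ w.head? = some a := by
    intro a u v P hP w
    rw [List.mem_map]
    constructor
    · rintro ⟨w, hw, rfl⟩
      exact ⟨((hP.mem_iff w).1 hw).cons a, rfl⟩
    · rintro ⟨hw, hh⟩
      cases w with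
      | nil => simp at hh
      | cons c w =>
        obtain rfl : c = a := by simpa using hh
        exact ⟨w, (hP.mem_iff w).2 hw.cons_inv, rfl⟩
  induction cs with
  | nil =>
    intro h a t hnd hp hlen _ _ hlast hd hpar
    obtain rfl : a = b := by simpa using hlast
    have hp' := hp.cons_inv
    have h1 := inversions_cons_add_cons a hp'
    obtain ⟨P, hP⟩ := IH (h :: t) (h' :: t') hlen hnd.of_cons hp' (by simpa [DistinctAtTwo] using hd) (by omega)
    refine ⟨P.map (List.cons a), hP.map (List.cons_injective) (fun _ _ => .cons a), fun w => ?_⟩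
    rw [mem_map_cons _ _ _ _ hP]
    simp
  | cons d cs ih =>
    intro h a t hnd hp hlen hcs hmem hlast hd hpar
    have hda : d ≠ a := by grind
    have hdt : d ∈ h :: t := by grind
    -- The exit of block `a`: `d` stands second, with parity opposite to the entry.
    obtain ⟨r, hr, hrp⟩ := exists_cons_perm_inversions_ne hnd.of_cons hdt (by omega)
      (inversions (h :: t))
    obtain ⟨P, hP⟩ := IH (h :: t) (d :: r) hlen hnd.of_cons hr
      (by simpa using hd.1) (Ne.symm hrp)
    have hperm : d :: a :: r ~ a :: h :: t := (List.Perm.swap a d r).trans (hr.cons a)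
    -- Crossing the block flips the parity and the connecting swap flips it back, so `hpar` persists
    -- for `d :: a :: r`.
    have h1 := inversions_cons_add_cons a hr
    have h2 := inversions_swap hda r
    obtain ⟨Q, hQ, hQm⟩ := ih a d r (hperm.nodup_iff.2 hnd) (hp.trans hperm.symm)
      (by have := hr.length_eq; simp at this hlen ⊢; omega) hcs.of_cons
      (fun x hx => hperm.mem_iff.2 (hmem x (by simp [hx]))) (by simpa using hlast) hd.2 (by omega)
    refine ⟨P.map (List.cons a) ++ Q,
      (hP.map List.cons_injective (fun _ _ => .cons a)).append hQ (.swap a d r) ?_, fun w => ?_⟩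
    · intro w hw hw'
      obtain ⟨x, hx, hwx⟩ := ((hQm w).1 hw').2
      have := ((mem_map_cons _ _ _ _ hP w).1 hw).2
      grind
    · rw [List.mem_append, mem_map_cons _ _ _ _ hP, hQm]
      have : w ~ d :: a :: r ↔ w ~ a :: h :: t :=
        ⟨fun hw => hw.trans hperm, fun hw => hw.trans hperm.symm⟩
      rw [this]
      grind

/-- In an order without repeated letters only the two boundary conditions can fail: the second
letter `d` must avoid `h`, and the penultimate letter `e` must avoid `h'`. Three letters besides `a`
and `b` leave room for both. -/
theorem exists_distinctAtTwo {a b h h' : α} {s : List α} (hs : s.Nodup) (hlen : 5 ≤ s.length)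
    (ha : a ∈ s) (hb : b ∈ s) (hab : a ≠ b) :
    ∃ cs, a :: cs ~ s ∧ (a :: cs).getLast? = some b ∧ DistinctAtTwo h a cs h' := by
  have hba : b ∈ s.erase a := (List.mem_erase_of_ne hab.symm).2 hb
  obtain ⟨r, hr⟩ : ∃ r, a :: b :: r ~ s :=
    ⟨_, (((List.perm_cons_erase hba).symm).cons a).trans (List.perm_cons_erase ha).symm⟩
  have hrn := hr.nodup_iff.2 hs
  have hrl : 3 ≤ r.length := by have := hr.length_eq; simp at this; omega
  obtain ⟨d, hdr, hdh⟩ : ∃ d ∈ r, d ≠ h := by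
    by_contra! hc
    have := (show r.Nodup by grind).subperm (l₂ := [h]) (fun x hx => by simp [hc x hx])
    have := this.length_le
    simp at this; omega
  obtain ⟨e, her, heh, hed⟩ : ∃ e ∈ r, e ≠ h' ∧ e ≠ d := by
    by_contra! hc
    have := (show r.Nodup by grind).subperm (l₂ := [h', d]) (fun x hx => by
      have := hc x hx; simp; tauto)
    have := this.length_le
    simp at this; omega
  have her' : e ∈ r.erase d := (List.mem_erase_of_ne hed).2 her
  obtain ⟨q, hq⟩ : ∃ q, d :: e :: q ~ r :=
    ⟨_, (((List.perm_cons_erase her').symm).cons d).trans (List.perm_cons_erase hdr).symm⟩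
  have hp : a :: d :: (q ++ [e, b]) ~ s := by
    refine List.Perm.trans (List.Perm.cons a ?_) hr
    refine List.Perm.trans ?_ (hq.cons b)
    have : q ++ [e, b] ~ e :: b :: q := List.perm_append_comm
    refine (this.cons d).trans ?_
    exact (List.Perm.swap e d (b :: q)).trans
      ((List.Perm.swap b d q).cons e |>.trans (List.Perm.swap b e (d :: q))) |>.trans
      ((List.Perm.swap d e q).cons b)
  refine ⟨d :: (q ++ [e, b]), hp, by simp [List.getLast?_cons], hdh.symm, ?_⟩
  exact distinctAtTwo_of_nodup (hp.nodup_iff.2 hs) heh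

theorem Laceable.succ {n : ℕ} (IH : Laceable α n) (hn : 4 ≤ n) : Laceable α (n + 1) := by
  intro u v hlen hnd hvu hhead hpar
  have hvlen := hvu.length_eq
  match u, v, hlen with
  | [_], _, h => simp at h; omega
  | a :: h :: t, [], _ => simp at hvlen
  | a :: h :: t, [_], _ => simp at hvlen
  | a :: h :: t, b :: h' :: t', hlen =>
    obtain ⟨cs, hcs, hlast, hd⟩ := exists_distinctAtTwo (a := a) (b := b) (h := h) (h' := h') hnd
      (by omega) (by simp) (hvu.mem_iff.1 (by simp)) (by simpa using hhead)
    obtain ⟨P, hP, hPm⟩ := IH.exists_isSwapPath_blocks (by omega) b h' t' cs h a t hnd hvu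
      (by simpa using hlen) (hcs.nodup_iff.2 hnd) (fun x hx => hcs.mem_iff.1 (by simp [hx]))
      hlast hd hpar
    refine ⟨P, hP, fun w => ?_⟩
    rw [hPm, and_iff_left_iff_imp]
    intro hw
    cases w with
    | nil => simpa using hw.length_eq
    | cons x w => exact ⟨x, hcs.mem_iff.2 (hw.mem_iff.1 (by simp)), rfl⟩

/-! ### Laceability: four letters, and the rotation path -/

/-- Swap sequences of paths through all rearrangements of a list of length four. -/
def fourWords : List (List ℕ) :=
  [[1, 0, 1, 0, 2, 0, 1, 0, 1, 0, 2, 0, 1, 2, 1, 0, 1, 0, 1, 2, 1, 0, 2],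
   [0, 1, 0, 2, 1, 0, 1, 2, 1, 2, 1, 0, 1, 2, 0, 2, 1, 2, 1, 0, 1, 2, 1],
   [0, 1, 0, 1, 0, 2, 0, 1, 0, 2, 0, 1, 0, 1, 0, 2, 1, 2, 0, 2, 1, 0, 1],
   [0, 1, 0, 1, 0, 2, 1, 0, 1, 2, 1, 2, 1, 0, 1, 0, 1, 2, 1, 0, 1, 2, 1],
   [0, 1, 2, 1, 0, 1, 2, 1, 2, 1, 0, 1, 0, 1, 2, 1, 2, 0, 2, 1, 2, 1, 2],
   [0, 1, 0, 1, 0, 2, 0, 1, 0, 2, 1, 2, 1, 2, 0, 2, 1, 0, 1, 2, 1, 0, 1],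
   [0, 1, 0, 1, 0, 2, 0, 1, 0, 1, 0, 2, 1, 0, 1, 2, 1, 0, 1, 0, 1, 2, 1],
   [0, 1, 0, 1, 0, 2, 0, 1, 0, 2, 0, 1, 0, 1, 2, 1, 0, 1, 2, 0, 2, 1, 2],
   [0, 1, 0, 1, 0, 2, 0, 1, 2, 1, 0, 1, 2, 1, 0, 1, 2, 0, 2, 1, 2, 1, 2]]

theorem fourWords_nodup : ∀ ks ∈ fourWords, (swapTrace ([0, 1, 2, 3] : List (Fin 4)) ks).Nodup := by
  decide +kernel

theorem fourWords_length : ∀ ks ∈ fourWords,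
    (∀ k ∈ ks, k < 3) ∧ (swapTrace ([0, 1, 2, 3] : List (Fin 4)) ks).length = 24 := by
  decide +kernel

/-- There are nine odd arrangements not starting with `0`, one for each word. -/
theorem fourWords_last : ∀ w ∈ List.permutations' ([0, 1, 2, 3] : List (Fin 4)), w.head? ≠ some 0 →
    inversions w % 2 ≠ 0 → ∃ ks ∈ fourWords, (swapTrace ([0, 1, 2, 3] : List (Fin 4)) ks).getLast? = some w := by
  decide +kernel

theorem laceable_four : Laceable α 4 := by
  intro u v hlen hnd hvu hhead hpar
  match u, hlen with
  | [a, b, c, d], _ =>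
    let f : Fin 4 → α := ![a, b, c, d]
    have hf : Function.Injective f := by
      rw [← List.nodup_ofFn]
      simpa [f, List.ofFn_succ] using hnd
    have hu : [a, b, c, d] = List.map f [0, 1, 2, 3] := rfl
    rw [hu, ← List.mem_permutations', ← List.map_permutations', List.mem_map] at hvu
    obtain ⟨w, hw, rfl⟩ := hvu
    have h0 : inversions ([0, 1, 2, 3] : List (Fin 4)) = 0 := by decide
    have hpw := inversions_map_add hf (List.mem_permutations'.1 hw).symm (by decide)
    rw [hu] at hpar hhead ⊢
    obtain ⟨ks, hks, hl⟩ := fourWords_last w hw (fun h => hhead (by simp [h])) (by omega)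
    have hpath : IsSwapPath [0, 1, 2, 3] w (swapTrace [0, 1, 2, 3] ks) :=
      ⟨swapTrace_isChain _ _ fun k hk => by
          have := (fourWords_length ks hks).1 k hk
          simp only [List.length_cons, List.length_nil]
          omega,
        swapTrace_head _ _, hl, fourWords_nodup ks hks⟩
    exact ⟨_, (hpath.map (List.map_injective_iff.2 hf) fun _ _ => AdjSwap.map f).isHamiltonSwapPath
      (by rw [List.length_map, (fourWords_length ks hks).2]; rfl)⟩

theorem laceable_of_four_le {n : ℕ} (hn : 4 ≤ n) : Laceable α n := by
  induction n, hn using Nat.le_induction with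
  | base => exact laceable_four
  | succ n hn ih => exact ih.succ hn

theorem exists_isHamiltonSwapPath_rotate (a : α) (l : List α) (hnd : (a :: l).Nodup)
    (hodd : Odd l.length) : ∃ P, IsHamiltonSwapPath (a :: l) (l ++ [a]) P := by
  have hpar := inversions_append_singleton a l hnd
  obtain ⟨k, hk⟩ := hodd
  -- Two letters lie below the range of `Laceable` used here and are handled by a single swap.
  rcases Nat.eq_zero_or_pos k with rfl | hk0
  · obtain ⟨b, rfl⟩ := List.length_eq_one_iff.1 hk
    refine ⟨[[a, b], [b, a]], IsSwapPath.isHamiltonSwapPath ⟨?_, rfl, rfl, ?_⟩ rfl⟩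
    · simpa using AdjSwap.swap a b []
    · simp at hnd ⊢; grind
  · have : Laceable α (l.length + 1) := laceable_of_four_le (by omega)
    refine this _ _ rfl hnd (List.perm_append_singleton a l) ?_ (by omega)
    cases l with
    | nil => simp at hk
    | cons b l => simp at hnd ⊢; grind

end ListPaths

/-! ### Hamilton cycles from periodic sequences -/

section Walks

theorem exists_walk_getVert_eq {V : Type*} {G : SimpleGraph V} (N : ℕ) (g : ℕ → V)
    (h : ∀ t, G.Adj (g t) (g (t + 1))) :
    ∃ p : G.Walk (g 0) (g N), p.length = N ∧ ∀ t ≤ N, p.getVert t = g t := by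
  induction N generalizing g with
  | zero => exact ⟨.nil, rfl, fun t ht => by obtain rfl : t = 0 := by omega
                                             rfl⟩
  | succ N ih =>
    obtain ⟨p, hp, hg⟩ := ih (fun t => g (t + 1)) (fun t => h _)
    refine ⟨.cons (h 0) p, by simp [hp], fun t ht => ?_⟩
    cases t with
    | zero => rfl
    | succ t => rw [SimpleGraph.Walk.getVert_cons_succ, hg t (by omega)]

theorem exists_isHamiltonianCycle {V : Type*} [DecidableEq V] [Fintype V] {G : SimpleGraph V}
    (g : ℕ → V) (h : ∀ t, G.Adj (g t) (g (t + 1))) (h3 : 3 ≤ Fintype.card V)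
    (hper : Function.Periodic g (Fintype.card V))
    (hinj : Set.InjOn g (Set.Iio (Fintype.card V))) :
    ∃ (a : V) (C : G.Walk a a), C.IsHamiltonianCycle ∧ C.length = Fintype.card V ∧
      ∀ t, vertexAt C t = g t := by
  obtain ⟨p, hp, hg⟩ := exists_walk_getVert_eq (Fintype.card V) g h
  have hN : g (Fintype.card V) = g 0 := by simpa using hper 0
  generalize hcard : Fintype.card V = N at *
  refine ⟨g 0, p.copy rfl hN, ?_, by simpa using hp, fun t => ?_⟩
  · rw [SimpleGraph.Walk.isHamiltonianCycle_iff_isCycle_and_length_eq,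
      SimpleGraph.Walk.isCycle_iff_isPath_tail_and_le_length,
      ← SimpleGraph.Walk.IsPath.getVert_injOn_iff, SimpleGraph.Walk.length_copy]
    have hnil' : ¬ (p.copy rfl hN).Nil := by
      rw [← SimpleGraph.Walk.length_eq_zero_iff, SimpleGraph.Walk.length_copy]; omega
    refine ⟨⟨fun s hs t ht hst => ?_, by omega⟩, hcard ▸ hp⟩
    have hl := SimpleGraph.Walk.length_tail_add_one hnil'
    rw [SimpleGraph.Walk.length_copy, hp] at hl
    simp only [Set.mem_ofPred_eq] at hs ht
    rw [SimpleGraph.Walk.getVert_tail, SimpleGraph.Walk.getVert_tail, SimpleGraph.Walk.getVert_copy,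
      SimpleGraph.Walk.getVert_copy, hg _ (by omega), hg _ (by omega), ← hper.map_mod_nat (s + 1),
      ← hper.map_mod_nat (t + 1)] at hst
    have hmod := hinj (Nat.mod_lt _ (by omega)) (Nat.mod_lt _ (by omega)) hst
    -- Index `s` of the tail is index `s + 1` of the cycle; only the value `N` wraps around, to `0`.
    rcases eq_or_ne (s + 1) N with h1 | h1 <;> rcases eq_or_ne (t + 1) N with h2 | h2
    · omega
    · rw [h1, Nat.mod_self, Nat.mod_eq_of_lt (by omega)] at hmod; omega
    · rw [h2, Nat.mod_self, Nat.mod_eq_of_lt (by omega)] at hmod; omega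
    · rw [Nat.mod_eq_of_lt (by omega), Nat.mod_eq_of_lt (by omega)] at hmod; omega
  · rw [vertexAt, SimpleGraph.Walk.getVert_copy, SimpleGraph.Walk.length_copy, hp,
      hg _ (Nat.mod_lt _ (by omega)).le, hper.map_mod_nat]

end Walks

/-! ### The cyclic shift and the edges of the graph -/

section Rotation

variable {m : ℕ}

theorem finRotate_pow_apply (k : ℕ) (p : Fin (m + 1)) :
    (finRotate (m + 1) ^ k) p = p + Fin.ofNat (m + 1) k := by
  induction k with
  | zero => simp
  | succ k ih =>
    rw [pow_succ', Equiv.Perm.mul_apply, ih, finRotate_apply]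
    simp only [Fin.ext_iff, Fin.val_add, Fin.val_ofNat, Fin.val_one', Nat.mod_add_mod, Nat.add_mod_mod,
      add_assoc]

theorem finRotate_pow_self : finRotate (m + 1) ^ (m + 1) = 1 := by
  ext p
  simp [finRotate_pow_apply]

theorem finRotate_mul_cyclicTransposition (i : Fin (m + 1)) :
    finRotate (m + 1) * cyclicTransposition (m + 1) i =
      cyclicTransposition (m + 1) (finRotate (m + 1) i) * finRotate (m + 1) := by
  rw [cyclicTransposition, cyclicTransposition, Equiv.mul_swap_eq_swap_mul]

/-- A coincidence for `i ≠ j` forces `i = j + 1` and `j = i + 1`, hence `1 + 1 = 0`, which fails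
modulo `m + 1 ≥ 3`. -/
theorem cyclicTransposition_injective (hm : 2 ≤ m) :
    Function.Injective (cyclicTransposition (m + 1)) := by
  intro i j h
  have h1 := congrArg (fun f : Equiv.Perm (Fin (m + 1)) => f i) h
  have h2 := congrArg (fun f : Equiv.Perm (Fin (m + 1)) => f j) h
  simp only [cyclicTransposition, finRotate_apply, Equiv.swap_apply_left] at h1 h2
  have h0 : (1 : Fin (m + 1)) ≠ 0 := by simp [Fin.ext_iff]; omega
  by_contra hij
  rw [Equiv.swap_apply_def, if_neg hij] at h1
  split_ifs at h1 with hc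
  · rw [hc, add_assoc, add_eq_left] at h1
    have := congrArg Fin.val h1
    rw [Fin.val_add, Fin.val_one', Fin.val_zero, Nat.mod_eq_of_lt (by omega : 1 < m + 1),
      Nat.mod_eq_of_lt (by omega)] at this
    omega
  · simp [h0] at h1

theorem permutahedronPlus_adj_mul_cyclicTransposition (hm : 1 ≤ m)
    (x : Equiv.Perm (Fin (m + 1))) (i : Fin (m + 1)) :
    (permutahedronPlus (m + 1)).Adj x (x * cyclicTransposition (m + 1) i) := by
  have hne : x ≠ x * cyclicTransposition (m + 1) i := by
    intro h
    have := Equiv.swap_eq_one_iff.1 (left_eq_mul.1 h)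
    rw [finRotate_apply, left_eq_add, Fin.ext_iff] at this
    simp at this
    omega
  rcases Fin.eq_castSucc_or_eq_last i with ⟨j, rfl⟩ | rfl
  · refine Or.inl ⟨hne, Or.inl ⟨j.castSucc, j.succ, by simp, ?_⟩⟩
    rw [cyclicTransposition, finRotate_apply, Fin.coeSucc_eq_succ]
  · refine Or.inr ⟨hne, Or.inl ⟨0, Fin.last m, by simp, by simp, ?_⟩⟩
    rw [cyclicTransposition, finRotate_last, Equiv.swap_comm]

theorem permutahedronPlus_adj_iff (hm : 1 ≤ m) (x y : Equiv.Perm (Fin (m + 1))) :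
    (permutahedronPlus (m + 1)).Adj x y ↔ ∃ i, y = x * cyclicTransposition (m + 1) i := by
  constructor
  · have key : ∀ x y : Equiv.Perm (Fin (m + 1)), ∀ i j : Fin (m + 1),
        finRotate (m + 1) i = j → y = x * Equiv.swap i j →
          (∃ i, y = x * cyclicTransposition (m + 1) i) ∧
            ∃ i, x = y * cyclicTransposition (m + 1) i := by
      rintro x y i j rfl rfl
      exact ⟨⟨i, rfl⟩, i, by rw [cyclicTransposition, mul_assoc, Equiv.swap_mul_self, mul_one]⟩
    have hsucc : ∀ i j : Fin (m + 1), (i : ℕ) + 1 = j → finRotate (m + 1) i = j := by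
      intro i j h
      rw [Fin.ext_iff, coe_finRotate_of_ne_last (by rw [Ne, Fin.ext_iff, Fin.val_last]; omega), h]
    have hlast : ∀ i j : Fin (m + 1), (i : ℕ) = 0 → (j : ℕ) + 1 = m + 1 →
        finRotate (m + 1) j = i := by
      intro i j hi hj
      obtain rfl : j = Fin.last m := Fin.ext (by simpa using hj)
      rw [finRotate_last, Fin.ext_iff, hi, Fin.val_zero]
    rintro (⟨-, ⟨i, j, h, e⟩ | ⟨i, j, h, e⟩⟩ | ⟨-, ⟨i, j, hi, hj, e⟩ | ⟨i, j, hi, hj, e⟩⟩)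
    · exact (key x y i j (hsucc i j h) e).1
    · exact (key y x i j (hsucc i j h) e).2
    · exact (key x y j i (hlast i j hi hj) (by rwa [Equiv.swap_comm])).1
    · exact (key y x j i (hlast i j hi hj) (by rwa [Equiv.swap_comm])).2
  · rintro ⟨i, rfl⟩
    exact permutahedronPlus_adj_mul_cyclicTransposition hm x i

end Rotation

/-! ### From lists to permutations -/

section Lists

variable {α : Type*}

theorem AdjSwap.exists_getElem? {l l' : List α} (h : AdjSwap l l') :
    ∃ i, i + 1 < l.length ∧ ∀ k, l'[k]? = l[Equiv.swap i (i + 1) k]? := by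
  induction h with
  | swap a b l =>
    refine ⟨0, by simp, fun k => ?_⟩
    rw [Equiv.swap_apply_def]
    match k with
    | 0 => rfl
    | 1 => rfl
    | k + 2 => simp
  | cons a _ ih =>
    obtain ⟨i, hi, h⟩ := ih
    refine ⟨i + 1, by simpa using hi, fun k => ?_⟩
    cases k with
    | zero => rw [Equiv.swap_apply_of_ne_of_ne] <;> simp
    | succ k =>
      have : Equiv.swap (i + 1) (i + 1 + 1) (k + 1) = Equiv.swap i (i + 1) k + 1 := by
        simp only [Equiv.swap_apply_def]; grind
      rw [this]
      simpa using h k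

variable {m : ℕ}

theorem exists_ofFn_eq {l : List (Fin m)} (h : l ~ List.finRange m) :
    ∃ x : Equiv.Perm (Fin m), List.ofFn x = l := by
  have hl : l.length = m := by simpa using h.length_eq
  have hnd : l.Nodup := h.nodup_iff.2 (List.nodup_finRange m)
  obtain ⟨f, rfl⟩ : ∃ f : Fin m → Fin m, List.ofFn f = l := by
    exact ⟨fun i => l[i], List.ext_getElem (by simp [hl]) (by simp)⟩
  rw [List.nodup_ofFn] at hnd
  exact ⟨Equiv.ofBijective f hnd.bijective_of_finite, rfl⟩

theorem getElem?_ofFn_val {β : Type*} (f : Fin m → β) (k : Fin m) :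
    (List.ofFn f)[(k : ℕ)]? = some (f k) := by
  simp

theorem eq_mul_cyclicTransposition_of_adjSwap {x y : Equiv.Perm (Fin (m + 1))}
    (h : AdjSwap (List.ofFn x) (List.ofFn y)) :
    ∃ i, y = x * cyclicTransposition (m + 1) i := by
  obtain ⟨i, hi, h⟩ := h.exists_getElem?
  rw [List.length_ofFn] at hi
  refine ⟨⟨i, by omega⟩, Equiv.ext fun k => ?_⟩
  have hk := h k
  have hr : finRotate (m + 1) ⟨i, by omega⟩ = ⟨i + 1, hi⟩ := finRotate_of_lt (by omega)
  have hs : Equiv.swap i (i + 1) (k : ℕ) =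
      (cyclicTransposition (m + 1) ⟨i, by omega⟩ k : Fin (m + 1)) := by
    rw [cyclicTransposition, hr]
    simp only [Equiv.swap_apply_def, Fin.ext_iff]
    split_ifs <;> rfl
  rw [hs, getElem?_ofFn_val, getElem?_ofFn_val, Option.some_inj] at hk
  exact hk

/-- Both sides are the string `a l z`: the left shift of `z a l`, and `z l a` with its ends swapped.
-/
theorem mul_finRotate_eq_of_ofFn {x y : Equiv.Perm (Fin (m + 1))} {z a : Fin (m + 1)}
    {l : List (Fin (m + 1))} (hx : List.ofFn x = z :: a :: l) (hy : List.ofFn y = z :: (l ++ [a])) :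
    x * finRotate (m + 1) = y * cyclicTransposition (m + 1) (Fin.last m) := by
  have hl : m = l.length + 1 := by simpa using congrArg List.length hx
  ext1 k
  rw [Equiv.Perm.mul_apply, Equiv.Perm.mul_apply, cyclicTransposition, finRotate_last,
    ← Option.some_inj, ← getElem?_ofFn_val, ← getElem?_ofFn_val, hx, hy]
  rcases Fin.eq_castSucc_or_eq_last k with ⟨j, rfl⟩ | rfl
  · rw [finRotate_apply, Fin.coeSucc_eq_succ, Equiv.swap_apply_def]
    have := j.2
    simp only [Fin.val_succ, List.getElem?_cons_succ, (Fin.castSucc_lt_last j).ne, if_false]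
    split_ifs with h0
    · have : (j : ℕ) = 0 := by simpa [Fin.ext_iff] using h0
      simp [this, hl]
    · obtain ⟨i, hi⟩ : ∃ i, (j : ℕ) = i + 1 :=
        Nat.exists_eq_succ_of_ne_zero (by simpa [Fin.ext_iff] using h0)
      simp [hi, List.getElem?_append_left (show i < l.length by omega)]
  · simp

end Lists

/-- A Hamilton path through the cyclic arrangements, each represented by the permutation with
entry `0` at position `0`, that ends next to the cyclic shift of its first vertex. -/
theorem exists_path_cyclicArrangements {m : ℕ} (hm : 2 ≤ m) (heven : Even m) :
    ∃ x : ℕ → Equiv.Perm (Fin (m + 1)),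
      (∀ j < m !, x j 0 = 0) ∧ Set.InjOn x (Set.Iio (m !)) ∧
      (∀ j, j + 1 < m ! → ∃ i, x (j + 1) = x j * cyclicTransposition (m + 1) i) ∧
      ∃ i, x 0 * finRotate (m + 1) = x ((m !) - 1) * cyclicTransposition (m + 1) i := by
  obtain ⟨a, l, hal⟩ : ∃ a l, (List.finRange m).map Fin.succ = a :: l := by
    apply List.exists_cons_of_ne_nil
    simp; omega
  have hfr : List.finRange (m + 1) = 0 :: a :: l := by rw [List.finRange_succ, hal]
  have hnd : (0 :: a :: l).Nodup := hfr ▸ List.nodup_finRange _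
  have hlen : l.length + 1 = m := by simpa using (congrArg List.length hal).symm
  obtain ⟨P, hP⟩ := exists_isHamiltonSwapPath_rotate a l hnd.of_cons
    (by rw [← hlen] at heven; rw [Nat.even_add_one] at heven; simpa using heven)
  have hPl : P.length = m ! := by rw [hP.length hnd.of_cons, List.length_cons, hlen]
  have hx : ∀ j : ℕ, ∃ x : Equiv.Perm (Fin (m + 1)), ∀ w, P[j]? = some w →
      List.ofFn x = 0 :: w := by
    intro j
    cases hw : P[j]? with
    | none => exact ⟨1, by simp⟩
    | some w =>
      have hp := (hP.mem_iff w).1 (List.mem_of_getElem? hw)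
      obtain ⟨x, hx⟩ := exists_ofFn_eq (l := 0 :: w) (hfr ▸ hp.cons 0)
      exact ⟨x, by rintro _ ⟨⟩; exact hx⟩
  choose x hx using hx
  have hx' : ∀ j (hj : j < m !), List.ofFn (x j) = 0 :: P[j] := fun j hj =>
    hx j _ (List.getElem?_eq_getElem (hPl ▸ hj))
  refine ⟨x, fun j hj => ?_, fun i hi j hj hij => ?_, fun j hj => ?_, Fin.last m, ?_⟩
  · have := congrArg (fun l => l[0]?) (hx' j hj)
    simpa using this
  · have h1 := hx' i hi
    rw [hij, hx' j hj, List.cons_inj_right] at h1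
    exact ((hP.nodup.getElem_inj_iff).1 h1).symm
  · apply eq_mul_cyclicTransposition_of_adjSwap
    rw [hx' j (by omega), hx' (j + 1) hj]
    exact .cons _ (List.isChain_iff_getElem.1 hP.chain j (by omega))
  · have := Nat.factorial_pos m
    refine mul_finRotate_eq_of_ofFn (hx 0 (a :: l) ?_) (hx _ (l ++ [a]) ?_)
    · rw [← List.head?_eq_getElem?, hP.head]
    · rw [← hPl, ← List.getLast?_eq_getElem?, hP.last]

/-! ### Lifting the path through all shifts -/

section Lift

variable {m M : ℕ} (x : ℕ → Equiv.Perm (Fin (m + 1)))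

/-- The sequence that runs through `x 0, …, x (M - 1)`, then through their cyclic shifts, and
so on. -/
def rotationLift (M : ℕ) (x : ℕ → Equiv.Perm (Fin (m + 1))) (t : ℕ) : Equiv.Perm (Fin (m + 1)) :=
  x (t % M) * finRotate (m + 1) ^ (t / M)

theorem rotationLift_add (hM : 0 < M) (t : ℕ) :
    rotationLift M x (t + M) = rotationLift M x t * finRotate (m + 1) := by
  rw [rotationLift, rotationLift, Nat.add_mod_right, Nat.add_div_right _ hM, pow_succ, mul_assoc]

theorem rotationLift_add_mul (hM : 0 < M) (t k : ℕ) :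
    rotationLift M x (t + k * M) = rotationLift M x t * finRotate (m + 1) ^ k := by
  induction k with
  | zero => simp
  | succ k ih => rw [Nat.succ_mul, ← add_assoc, rotationLift_add x hM, ih, pow_succ, mul_assoc]

theorem rotationLift_periodic (hM : 0 < M) :
    Function.Periodic (rotationLift M x) ((m + 1) * M) := fun t => by
  rw [rotationLift_add_mul x hM, finRotate_pow_self, mul_one]

/-- Moving the shift past a transposition changes its index by one; this is the source of balance.
-/
theorem rotationLift_add_one_add_iff (hM : 0 < M) (t : ℕ) (i : Fin (m + 1)) :
    rotationLift M x (t + M + 1) = rotationLift M x (t + M) * cyclicTransposition (m + 1) i ↔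
      rotationLift M x (t + 1) =
        rotationLift M x t * cyclicTransposition (m + 1) (finRotate (m + 1) i) := by
  rw [add_right_comm, rotationLift_add x hM, rotationLift_add x hM, mul_assoc,
    finRotate_mul_cyclicTransposition, ← mul_assoc, mul_left_inj]

variable {x}

theorem exists_rotationLift_add_one (hM : 0 < M)
    (hx : ∀ j, j + 1 < M → ∃ i, x (j + 1) = x j * cyclicTransposition (m + 1) i)
    (hlast : ∃ i, x 0 * finRotate (m + 1) = x (M - 1) * cyclicTransposition (m + 1) i) (t : ℕ) :
    ∃ i, rotationLift M x (t + 1) = rotationLift M x t * cyclicTransposition (m + 1) i := by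
  induction t using Nat.strong_induction_on with
  | _ t ih =>
    rcases lt_or_ge t M with ht | ht
    · by_cases h1 : t + 1 < M
      · simpa [rotationLift, Nat.mod_eq_of_lt, Nat.div_eq_of_lt, ht, h1] using hx t h1
      · obtain rfl : M = t + 1 := by omega
        simpa [rotationLift, Nat.mod_eq_of_lt, Nat.div_eq_of_lt] using hlast
    · obtain ⟨i, hi⟩ := ih (t - M) (by omega)
      refine ⟨(finRotate (m + 1)).symm i, ?_⟩
      have := (rotationLift_add_one_add_iff x hM (t - M) ((finRotate (m + 1)).symm i)).2
        (by rwa [Equiv.apply_symm_apply])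
      rwa [Nat.sub_add_cancel ht] at this

theorem rotationLift_injOn (hx0 : ∀ j < M, x j 0 = 0) (hinj : Set.InjOn x (Set.Iio M)) :
    Set.InjOn (rotationLift M x) (Set.Iio ((m + 1) * M)) := by
  intro s hs t ht hst
  simp only [Set.mem_Iio] at hs ht
  have hM : 0 < M := Nat.pos_of_ne_zero (by rintro rfl; simp at hs)
  have hs' : s / M < m + 1 := Nat.div_lt_of_lt_mul (by rwa [mul_comm])
  have ht' : t / M < m + 1 := Nat.div_lt_of_lt_mul (by rwa [mul_comm])
  -- In round `s / M` the symbol `0` sits at position `-(s / M)`, so its position determines the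
  -- round.
  have key := congrArg (fun f : Equiv.Perm (Fin (m + 1)) => f (-Fin.ofNat (m + 1) (s / M))) hst
  simp only [rotationLift, Equiv.Perm.mul_apply, finRotate_pow_apply, neg_add_cancel] at key
  rw [hx0 _ (Nat.mod_lt _ hM), ← hx0 _ (Nat.mod_lt t hM), EmbeddingLike.apply_eq_iff_eq,
    eq_comm, neg_add_eq_zero] at key
  have hdiv : s / M = t / M := by
    have := congrArg Fin.val key
    rwa [Fin.val_ofNat, Fin.val_ofNat, Nat.mod_eq_of_lt hs', Nat.mod_eq_of_lt ht'] at this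
  rw [rotationLift, rotationLift, hdiv, mul_left_inj] at hst
  have hmod := hinj (Nat.mod_lt s hM) (Nat.mod_lt t hM) hst
  rw [← Nat.div_add_mod s M, ← Nat.div_add_mod t M, hdiv, hmod]

/-- Right multiplication by the cyclic shift of the positions. -/
def rotationAutomorphism (m : ℕ) (hm : 1 ≤ m) :
    permutahedronPlus (m + 1) ≃g permutahedronPlus (m + 1) where
  toEquiv := Equiv.mulRight (finRotate (m + 1))
  map_rel_iff' {x y} := by
    rw [permutahedronPlus_adj_iff hm, permutahedronPlus_adj_iff hm]
    refine (finRotate (m + 1)).exists_congr fun i => ?_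
    rw [Equiv.coe_mulRight, mul_assoc, finRotate_mul_cyclicTransposition, ← mul_assoc, mul_left_inj]

/-- Delaying by `M` matches the uses of index `i + 1` in one period with those of `i` in a shifted
period, so by periodicity all indices have equal counts. Every step uses exactly one index, so the
`m + 1` counts add up to `(m + 1) * M`. -/
theorem card_filter_rotationLift (hm : 2 ≤ m) (hM : 0 < M)
    (hstep : ∀ t, ∃ i,
      rotationLift M x (t + 1) = rotationLift M x t * cyclicTransposition (m + 1) i)
    (i : Fin (m + 1)) :
    ((Finset.range ((m + 1) * M)).filter fun t =>
      rotationLift M x (t + 1) = rotationLift M x t * cyclicTransposition (m + 1) i).card = M := by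
  set A : Fin (m + 1) → Finset ℕ := fun i => (Finset.range ((m + 1) * M)).filter fun t =>
      rotationLift M x (t + 1) = rotationLift M x t * cyclicTransposition (m + 1) i with hA
  have hper := rotationLift_periodic x hM
  have hrot : ∀ i, (A (finRotate (m + 1) i)).card = (A i).card := by
    intro i
    have hp : Function.Periodic (fun t =>
      rotationLift M x (t + 1) = rotationLift M x t * cyclicTransposition (m + 1) i)
        ((m + 1) * M) := fun t => by
      simp only [add_right_comm t _ 1, hper t, hper (t + 1)]
    have h1 := Nat.filter_Ico_card_eq_of_periodic M _ _ hp
    rw [Nat.count_eq_card_filter_range] at h1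
    rw [hA, ← h1]
    refine Finset.card_bij (fun t _ => t + M) ?_ (by simp) ?_
    · intro t ht
      simp only [Finset.mem_filter, Finset.mem_range, Finset.mem_Ico] at ht ⊢
      exact ⟨by omega, (rotationLift_add_one_add_iff x hM t i).2 ht.2⟩
    · intro t ht
      simp only [Finset.mem_filter, Finset.mem_Ico] at ht
      obtain ⟨s, rfl⟩ := Nat.exists_eq_add_of_le' ht.1.1
      refine ⟨s, ?_, rfl⟩
      simp only [Finset.mem_filter, Finset.mem_range]
      exact ⟨by omega, (rotationLift_add_one_add_iff x hM s i).1 ht.2⟩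
  have hconst : ∀ j, (A j).card = (A i).card := by
    have hpow : ∀ k : ℕ, (A ((finRotate (m + 1) ^ k) i)).card = (A i).card := by
      intro k
      induction k with
      | zero => rfl
      | succ k ih => rw [pow_succ', Equiv.Perm.mul_apply, hrot, ih]
    intro j
    rw [← hpow (j - i : Fin (m + 1)), finRotate_pow_apply]
    simp
  have hunion : Finset.univ.biUnion A = Finset.range ((m + 1) * M) := by
    ext t
    simp only [hA, Finset.mem_biUnion, Finset.mem_univ, true_and, Finset.mem_filter]
    exact ⟨fun ⟨_, h, _⟩ => h, fun h => (hstep t).imp fun i hi => ⟨h, hi⟩⟩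
  have hdisj : ((Finset.univ : Finset (Fin (m + 1))) : Set (Fin (m + 1))).PairwiseDisjoint A := by
    intro j _ k _ hjk
    refine Finset.disjoint_left.2 fun t hj hk => hjk (cyclicTransposition_injective hm ?_)
    simp only [hA, Finset.mem_filter] at hj hk
    exact mul_left_cancel (hj.2.symm.trans hk.2)
  have hcard := Finset.card_biUnion hdisj
  rw [hunion, Finset.card_range, Finset.sum_congr rfl fun j _ => hconst j] at hcard
  simp only [Finset.sum_const, Finset.card_univ, Fintype.card_fin, smul_eq_mul] at hcard
  exact (Nat.eq_of_mul_eq_mul_left (by omega) hcard).symm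

end Lift

end HamiltonCompression

/-! ### Assembling the cycle -/

theorem mainTheorem10 (n : ℕ) (hn : 3 ≤ n) (hodd : Odd n) :
    ∃ (a : Equiv.Perm (Fin n)) (C : (HamiltonCompression.permutahedronPlus n).Walk a a),
      C.IsHamiltonianCycle ∧
      HamiltonCompression.IsSymmetric C n ∧
      HamiltonCompression.HasTracks C 1 ∧
      ∀ i : Fin n, HamiltonCompression.transpositionCount C i = (n - 1)! := by
  open HamiltonCompression in
  obtain ⟨m, rfl⟩ : ∃ m, n = m + 1 := ⟨n - 1, by omega⟩
  have hm : 2 ≤ m := by omega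
  have hM : 0 < m ! := Nat.factorial_pos m
  obtain ⟨x, hx0, hinj, hx, hlast⟩ := exists_path_cyclicArrangements hm
    (by rw [Nat.odd_add_one] at hodd; simpa using hodd)
  have hstep := exists_rotationLift_add_one hM hx hlast
  have hcard : Fintype.card (Equiv.Perm (Fin (m + 1))) = (m + 1) * m ! := by
    rw [Fintype.card_perm, Fintype.card_fin, Nat.factorial_succ]
  obtain ⟨a, C, hC, hlen, hv⟩ := exists_isHamiltonianCycle (G := permutahedronPlus (m + 1))
    (rotationLift (m !) x)
    (fun t => by
      obtain ⟨i, hi⟩ := hstep t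
      rw [hi]
      exact permutahedronPlus_adj_mul_cyclicTransposition (by omega) _ i)
    (by rw [hcard]; nlinarith) (hcard ▸ rotationLift_periodic x hM)
    (hcard ▸ rotationLift_injOn hx0 hinj)
  rw [hcard] at hlen
  refine ⟨a, C, hC, ⟨hlen ▸ dvd_mul_right _ _, rotationAutomorphism m (by omega), fun t => ?_⟩,
    -- Column `j` is column `0` read `j` rounds later, that is `j * m !` steps ahead.
    ⟨{0}, rfl, fun j => ⟨0, by simp, j * m !, fun t => ?_⟩⟩, fun i => ?_⟩
  · rw [hlen, Nat.mul_div_cancel_left _ (by omega), hv, hv, rotationLift_add x hM]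
    rfl
  · rw [hv, hv, rotationLift_add_mul x hM, Equiv.Perm.mul_apply, finRotate_pow_apply]
    simp
  · simp only [transpositionCount, hlen, hv]
    exact card_filter_rotationLift hm hM hstep i
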